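/- Let $\mathcal G$ be a (discrete) groupoid with unit space $\mathcal G^{(0)}$, source $d$ and range $r$, and write $\mathcal G_u^v=\{g: d(g)=u,\ r(g)=v\}$. All spaces below are non-empty compact Hausdorff. A $\mathcal G$-space is a bundle $\mathcal X=\{X_u\}_{u\in\mathcal G^{(0)}}$ of such spaces with homeomorphisms $x\mapsto g\cdot x$ from $X_{d(g)}$ onto $X_{r(g)}$ for $g\in\mathcal G$, where units act as identities and $(gh)\cdot x=g\cdot(h\cdot x)$ for composable $g,h$. A $\mathcal G$-subspace is a family of non-empty closed sets $Y_u\subseteq X_u$ with $g\cdot Y_{d(g)}=Y_{r(g)}$ for all $g$. Let $P(X_u)$ be the set of Radon probability measures on $X_u$ with the weak$^*$ topology; $X_u\subseteq P(X_u)$ as the point masses, and $\mathcal P(\mathcal X)=\{P(X_u)\}_u$ carries the push-forward action. A $\mathcal G$-map is a family of continuous maps $\phi_u:X_u\to Y_u$ with $g\cdot\phi_{d(g)}(x)=\phi_{r(g)}(g\cdot x)$; if all $\phi_u$ are onto, then $\mathcal Y$ is a $\mathcal G$-quotient of $\mathcal X$; a $\mathcal G$-isomorphism is a $\mathcal G$-map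 with an inverse $\mathcal G$-map. $\mathcal X$ is minimal if its only $\mathcal G$-subspace is $\mathcal X$, strongly proximal if $\overline{\mathcal G_u^v\cdot\mu}\cap X_v\neq\emptyset$ whenever $\mathcal G_u^v\ne\emptyset$ and $\mu\in P(X_u)$, and a $\mathcal G$-boundary if it is both. A Furstenberg boundary of $\mathcal G$ is a $\mathcal G$-boundary of which every $\mathcal G$-boundary is a $\mathcal G$-quotient. Then: 1. A Furstenberg boundary $\partial_F\mathcal G$ exists. 2. Any two Furstenberg boundaries of $\mathcal G$ are $\mathcal G$-isomorphic. 3. There is a set-indexed family $(\mathcal X_i)_{i\in I}$ of $\mathcal G$-boundaries that contains every $\mathcal G$-boundary up to $\mathcal G$-isomorphism; and for every such family the product $\prod_{i\in I}\mathcal X_i$ (with the diagonal action) has a minimal $\mathcal G$-subspace, and every minimal $\mathcal G$-subspace of it is a Furstenberg boundary. 4. Let $\mathcal X$ be a $\mathcal G$-boundary and $\mathcal Y$ a minimal $\mathcal G$-space. Every $\mathcal G$-map $\{\phi_u\}$ from $\mathcal Y$ into $\mathcal P(\mathcal X)$ satisfies $\phi_u(Y_u)=X_u$ for all $u$, and there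 is at most one such $\mathcal G$-map. Likewise, every family of unital completely positive maps $\varphi_u:C(X_u)\to C(Y_u)$ that intertwines the actions $(g\cdot f)(x)=f(g^{-1}\cdot x)$ consists of isometric $*$-homomorphisms, and there is at most one such family. -/

import Mathlib

open CategoryTheory MeasureTheory
open scoped CStarAlgebra ComplexOrder

universe u v w t s

noncomputable section

/-! ### Radon probability measures -/

section Radon

attribute [local instance] borel

/-- Every topological space is a Borel space for its Borel sigma-algebra. -/
theorem borelSpace_borel (X : Type t) [TopologicalSpace X] : BorelSpace X := ⟨rfl⟩

attribute [local instance] borelSpace_borel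

/-- `P(X)`: the regular Borel probability measures on `X`. -/
def RadonProb (X : Type t) [TopologicalSpace X] : Type t :=
  {μ : ProbabilityMeasure X // (μ : Measure X).Regular}

namespace RadonProb

variable {X : Type t} {Y : Type s} [TopologicalSpace X] [TopologicalSpace Y]

/-- The weak-* topology on `P(X)` (the coarsest one for which `μ ↦ ∫ f dμ` is continuous for every
bounded continuous `f`). -/
instance instTopologicalSpace : TopologicalSpace (RadonProb X) :=
  inferInstanceAs
    (TopologicalSpace {μ : ProbabilityMeasure X // (μ : Measure X).Regular})

/-- The copy of `X` inside `P(X)`: the set of all point masses. -/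
def pointMasses (X : Type t) [TopologicalSpace X] : Set (RadonProb X) :=
  {μ | ∃ x : X, (μ.1 : Measure X) = Measure.dirac x}

/-- The push-forward of a measure along a homeomorphism, `(e_* μ)(E) = μ(e⁻¹ E)`. -/
def map (e : X ≃ₜ Y) (μ : RadonProb X) : RadonProb Y :=
  ⟨μ.1.map e.continuous.measurable.aemeasurable, by
    have := μ.2
    rw [ProbabilityMeasure.toMeasure_map]
    exact Measure.Regular.map e⟩

theorem continuous_map (e : X ≃ₜ Y) : Continuous (map e : RadonProb X → RadonProb Y) :=
  Continuous.subtype_mk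
    ((ProbabilityMeasure.continuous_map e.continuous).comp continuous_subtype_val) _

theorem map_refl (μ : RadonProb X) : map (Homeomorph.refl X) μ = μ := by
  apply Subtype.ext
  apply ProbabilityMeasure.toMeasure_injective
  change Measure.map id _ = _
  exact Measure.map_id

theorem map_map {Z : Type w} [TopologicalSpace Z] (e : X ≃ₜ Y) (f : Y ≃ₜ Z) (μ : RadonProb X) :
    map f (map e μ) = map (e.trans f) μ := by
  apply Subtype.ext
  apply ProbabilityMeasure.toMeasure_injective
  exact Measure.map_map f.continuous.measurable e.continuous.measurable

/-- The homeomorphism `P(X) ≃ P(Y)` induced by a homeomorphism `X ≃ Y`. -/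
def mapHomeomorph (e : X ≃ₜ Y) : RadonProb X ≃ₜ RadonProb Y where
  toFun := map e
  invFun := map e.symm
  left_inv μ := by rw [map_map, Homeomorph.self_trans_symm, map_refl]
  right_inv μ := by rw [map_map, Homeomorph.symm_trans_self, map_refl]
  continuous_toFun := continuous_map e
  continuous_invFun := continuous_map e.symm

end RadonProb

end Radon

/-! ### Spaces with an action of a groupoid -/

/-- A bundle of topological spaces over the unit space of `𝒢` with an action of `𝒢` by
homeomorphisms between fibres. An arrow `g : a ⟶ b` has source `d(g) = a` and range `r(g) = b`,
and the groupoid product `hg` is `g ≫ h`. -/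
structure GSpace (𝒢 : Type u) [Groupoid.{v} 𝒢] where
  fibre : 𝒢 → Type t
  [top : ∀ a, TopologicalSpace (fibre a)]
  act : ∀ {a b : 𝒢}, (a ⟶ b) → fibre a ≃ₜ fibre b
  act_id : ∀ (a : 𝒢) (x : fibre a), act (𝟙 a) x = x
  act_comp : ∀ {a b c : 𝒢} (g : a ⟶ b) (h : b ⟶ c) (x : fibre a), act (g ≫ h) x = act h (act g x)

attribute [instance] GSpace.top

/-- A `𝒢`-map: a family of continuous maps between fibres that intertwines the actions. -/
@[ext]
structure GMap {𝒢 : Type u} [Groupoid.{v} 𝒢] (X : GSpace.{u, v, t} 𝒢) (Y : GSpace.{u, v, s} 𝒢) where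
  toFun : ∀ a, X.fibre a → Y.fibre a
  continuous_toFun : ∀ a, Continuous (toFun a)
  map_act : ∀ {a b : 𝒢} (g : a ⟶ b) (x : X.fibre a), Y.act g (toFun a x) = toFun b (X.act g x)

/-- A `𝒢`-subspace of a bundle (spaces being compact and non-empty): a family of non-empty compact
subsets of the fibres which every arrow maps onto each other. -/
structure GSubspace {𝒢 : Type u} [Groupoid.{v} 𝒢] (X : GSpace.{u, v, t} 𝒢) where
  carrier : ∀ a, Set (X.fibre a)
  isCompact : ∀ a, IsCompact (carrier a)
  nonempty : ∀ a, (carrier a).Nonempty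
  image_act : ∀ {a b : 𝒢} (g : a ⟶ b), X.act g '' carrier a = carrier b

namespace GSpace

variable {𝒢 : Type u} [Groupoid.{v} 𝒢]

/-- All fibres are non-empty compact Hausdorff spaces. -/
class IsCompactHausdorff (X : GSpace.{u, v, t} 𝒢) : Prop where
  compact : ∀ a, CompactSpace (X.fibre a)
  t2 : ∀ a, T2Space (X.fibre a)
  nonempty : ∀ a, Nonempty (X.fibre a)

attribute [instance] IsCompactHausdorff.compact IsCompactHausdorff.t2 IsCompactHausdorff.nonempty

/-- The bundle `P(X)` of Radon probability measures, with the action by push-forward. -/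
def prob (X : GSpace.{u, v, t} 𝒢) : GSpace.{u, v, t} 𝒢 where
  fibre a := RadonProb (X.fibre a)
  act g := RadonProb.mapHomeomorph (X.act g)
  act_id a μ := by
    have h : X.act (𝟙 a) = Homeomorph.refl _ := Homeomorph.ext (X.act_id a)
    change RadonProb.map (X.act (𝟙 a)) μ = μ
    rw [h, RadonProb.map_refl]
  act_comp {a b c} g h μ := by
    have e : X.act (g ≫ h) = (X.act g).trans (X.act h) := Homeomorph.ext (X.act_comp g h)
    change RadonProb.map (X.act (g ≫ h)) μ = RadonProb.map (X.act h) (RadonProb.map (X.act g) μ)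
    rw [e, RadonProb.map_map]

/-- The product of a family of `𝒢`-spaces, with the diagonal action. -/
def prod {I : Type s} (X : I → GSpace.{u, v, t} 𝒢) : GSpace.{u, v, max s t} 𝒢 where
  fibre a := ∀ i, (X i).fibre a
  act g := Homeomorph.piCongrRight fun i => (X i).act g
  act_id a x := funext fun i => (X i).act_id a (x i)
  act_comp g h x := funext fun i => (X i).act_comp g h (x i)

/-- `X` is minimal: it has no proper `𝒢`-subspace. -/
def IsMinimal (X : GSpace.{u, v, t} 𝒢) : Prop :=
  ∀ (Y : GSubspace X) (a : 𝒢), Y.carrier a = Set.univ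

/-- `X` is strongly proximal: whenever there are arrows from `a` to `b`, for every `μ ∈ P(X_a)` the
weak-* closure of `{g • μ | g : a ⟶ b}` in `P(X_b)` contains a point mass. -/
def IsStronglyProximal (X : GSpace.{u, v, t} 𝒢) : Prop :=
  ∀ a b : 𝒢, Nonempty (a ⟶ b) → ∀ μ : RadonProb (X.fibre a),
    (closure (Set.range fun g : a ⟶ b => X.prob.act g μ) ∩
      RadonProb.pointMasses (X.fibre b)).Nonempty

/-- A `𝒢`-boundary: a compact `𝒢`-space which is minimal and strongly proximal. -/
def IsBoundary (X : GSpace.{u, v, t} 𝒢) : Prop :=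
  X.IsCompactHausdorff ∧ X.IsMinimal ∧ X.IsStronglyProximal

/-- `Y` is a `𝒢`-quotient of `X`: there is a fibrewise surjective `𝒢`-map from `X` to `Y`. -/
def IsQuotientOf (Y : GSpace.{u, v, s} 𝒢) (X : GSpace.{u, v, t} 𝒢) : Prop :=
  ∃ Φ : GMap X Y, ∀ a, Function.Surjective (Φ.toFun a)

/-- `X` and `Y` are `𝒢`-isomorphic: there are mutually inverse `𝒢`-maps between them. -/
def Isomorphic (X : GSpace.{u, v, t} 𝒢) (Y : GSpace.{u, v, s} 𝒢) : Prop :=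
  ∃ (Φ : GMap X Y) (Ψ : GMap Y X),
    (∀ a x, Ψ.toFun a (Φ.toFun a x) = x) ∧ ∀ a y, Φ.toFun a (Ψ.toFun a y) = y

/-- `F` is a Furstenberg boundary of `𝒢`: a `𝒢`-boundary of which every `𝒢`-boundary is a
`𝒢`-quotient. -/
def IsFurstenbergBoundary (F : GSpace.{u, v, t} 𝒢) : Prop :=
  F.IsBoundary ∧ ∀ X : GSpace.{u, v, t} 𝒢, X.IsBoundary → X.IsQuotientOf F

/-- The family `X` consists of `𝒢`-boundaries, and contains every one up to `𝒢`-isomorphism. -/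
def IsCompleteFamilyOfBoundaries {I : Type s} (X : I → GSpace.{u, v, t} 𝒢) : Prop :=
  (∀ i, (X i).IsBoundary) ∧ ∀ Z : GSpace.{u, v, t} 𝒢, Z.IsBoundary → ∃ i, (X i).Isomorphic Z

/-- The action of `g` on continuous functions, `(g • f)(x) = f(g⁻¹ • x)`. -/
def translate (X : GSpace.{u, v, t} 𝒢) {a b : 𝒢} (g : a ⟶ b) (f : C(X.fibre a, ℂ)) :
    C(X.fibre b, ℂ) :=
  ⟨fun x => f (X.act (Groupoid.inv g) x), f.continuous.comp (X.act (Groupoid.inv g)).continuous⟩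

end GSpace

/-- A `𝒢`-subspace as a `𝒢`-space, with the restricted topology and action. -/
def GSubspace.toGSpace {𝒢 : Type u} [Groupoid.{v} 𝒢] {X : GSpace.{u, v, t} 𝒢} (Y : GSubspace X) :
    GSpace.{u, v, t} 𝒢 where
  fibre a := Y.carrier a
  act {a b} g := (X.act g).subtype fun x => by
    rw [← Y.image_act g]
    exact ((X.act g).injective.mem_set_image).symm
  act_id a x := Subtype.ext (X.act_id a x)
  act_comp g h x := Subtype.ext (X.act_comp g h x)

/-- A `𝒢`-morphism from the groupoid dynamical system `{C(X_a)}` to `{C(Y_a)}`: a family of unital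
completely positive maps that intertwines the actions. -/
structure FunctionMorphism {𝒢 : Type u} [Groupoid.{v} 𝒢] (X : GSpace.{u, v, t} 𝒢)
    (Y : GSpace.{u, v, s} 𝒢) [X.IsCompactHausdorff] [Y.IsCompactHausdorff] where
  toFun : ∀ a, C(X.fibre a, ℂ) →CP C(Y.fibre a, ℂ)
  map_one : ∀ a, toFun a 1 = 1
  map_translate : ∀ {a b : 𝒢} (g : a ⟶ b) (f : C(X.fibre a, ℂ)),
    Y.translate g (toFun a f) = toFun b (X.translate g f)

/-- A `𝒢`-morphism consisting of isometric `*`-homomorphisms. -/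
def FunctionMorphism.IsStarIsometric {𝒢 : Type u} [Groupoid.{v} 𝒢] {X : GSpace.{u, v, t} 𝒢}
    {Y : GSpace.{u, v, s} 𝒢} [X.IsCompactHausdorff] [Y.IsCompactHausdorff]
    (Φ : FunctionMorphism X Y) : Prop :=
  ∀ a, (∀ f h, Φ.toFun a (f * h) = Φ.toFun a f * Φ.toFun a h) ∧
    (∀ f, Φ.toFun a (star f) = star (Φ.toFun a f)) ∧ Isometry (Φ.toFun a)

end

/-!
A Radon probability measure on a compact Hausdorff space `X` is the same as a state on `C(X, ℝ)`
(`RadonProb.stateHomeomorph`), and the point masses are the characters, i.e. the states `L` with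
`L (f²) = (L f)²` for all `f` (`RadonProb.mem_pointMasses_iff`). In this picture the space of measures
is compact by Tychonoff's theorem, push-forward is precomposition, and being a point mass is a closed
condition which, by the Stone-Weierstrass theorem, can be tested on the marginals along any family of
maps that separates points (`State.isCharacter_of_separating`).

*Strong proximality of products.* Let `X` be mapped by `𝒢`-maps that jointly separate points into
strongly proximal spaces. In the closed orbit of a state on `X`, one marginal after the other can be
made a character without losing the previous ones, and by compactness all of them can be at once
(`GSpace.IsStronglyProximal.of_separating`). So a subspace of a product of boundaries is strongly
proximal; if it is minimal, it is a boundary, and its projections to the factors are onto.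

*A set of representatives.* Orbits in a minimal space are dense, so a point of the fibre over `a` is
determined by the collection of those subsets of `a ⟶ a` whose orbit adheres to it. Hence, up to
isomorphism, all boundaries have subsets of `Set (Set (a ⟶ a))` as fibres, and these form a set
(`GSpace.isCompleteFamilyOfBoundaries_boundaryCode`). A minimal subspace of the product of all of them,
which exists by Zorn's lemma, is a Furstenberg boundary.

*Rigidity.* Let `Φ` be a `𝒢`-map from a minimal space `Y` into the states of a boundary `X`. The closed
set of points of `Y` with image a character is invariant, and non-empty by strong proximality, so it is
all of `Y` (`GSpace.isCharacter_of_isMinimal`); the points of `X` so obtained form a subspace, which is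
`X` by minimality. Applied to the midpoint of two such maps, this shows that they agree, since characters
are extreme (`GSpace.eq_of_isMinimal`). Uniqueness of the Furstenberg boundary follows, as does the
statement on unital completely positive maps `φ`, which define states `f ↦ φ(f)(y)`.
-/

noncomputable section

/-! ### States on the algebra of continuous functions -/

/-- A state on `C(X, ℝ)`: a positive linear functional that takes the value `1` at `1`. -/
structure State (X : Type t) [TopologicalSpace X] where
  toLinearMap : C(X, ℝ) →ₗ[ℝ] ℝ
  nonneg : ∀ f, 0 ≤ f → 0 ≤ toLinearMap f
  map_one : toLinearMap 1 = 1

namespace State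

variable {X : Type t} {Y : Type s} {Z : Type w}
  [TopologicalSpace X] [TopologicalSpace Y] [TopologicalSpace Z]

instance : FunLike (State X) C(X, ℝ) ℝ where
  coe L := L.toLinearMap
  coe_injective L M h := by
    cases L; cases M; congr; exact DFunLike.coe_injective h

instance : LinearMapClass (State X) ℝ C(X, ℝ) ℝ where
  map_add L := _root_.map_add L.toLinearMap
  map_smulₛₗ L := L.toLinearMap.map_smul

@[ext]
theorem ext {L M : State X} (h : ∀ f, L f = M f) : L = M := DFunLike.ext _ _ h

@[simp]
theorem apply_one (L : State X) : L 1 = 1 := L.map_one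

theorem apply_nonneg (L : State X) {f : C(X, ℝ)} (hf : 0 ≤ f) : 0 ≤ L f := L.nonneg f hf

theorem apply_mono (L : State X) {f g : C(X, ℝ)} (h : f ≤ g) : L f ≤ L g := by
  have := L.apply_nonneg (sub_nonneg.2 h)
  rw [map_sub] at this
  linarith

theorem apply_smul_one (L : State X) (c : ℝ) : L (c • 1) = c := by simp

/-- The weak-* topology on states. -/
instance : TopologicalSpace (State X) := .induced (fun L f => L f) inferInstance

theorem continuous_eval (f : C(X, ℝ)) : Continuous fun L : State X => L f :=
  (continuous_apply f).comp continuous_induced_dom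

theorem continuous_iff {A : Type*} [TopologicalSpace A] {φ : A → State X} :
    Continuous φ ↔ ∀ f : C(X, ℝ), Continuous fun a => φ a f := by
  rw [continuous_induced_rng, continuous_pi_iff]
  rfl

instance : T2Space (State X) :=
  T2Space.of_injective_continuous (f := fun (L : State X) (f : C(X, ℝ)) => L f)
    DFunLike.coe_injective continuous_induced_dom

/-- The push-forward of a state along a continuous map. -/
def map (p : C(X, Y)) (L : State X) : State Y where
  toLinearMap := L.toLinearMap ∘ₗ (ContinuousMap.compRightAlgHom ℝ ℝ p).toLinearMap
  nonneg _ hf := L.nonneg _ fun x => hf (p x)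
  map_one := L.map_one

@[simp]
theorem map_apply (p : C(X, Y)) (L : State X) (f : C(Y, ℝ)) : map p L f = L (f.comp p) := rfl

theorem continuous_map (p : C(X, Y)) : Continuous (map p) :=
  continuous_iff.2 fun f => continuous_eval (f.comp p)

/-- The homeomorphism between state spaces induced by a homeomorphism. -/
def mapHomeomorph (e : X ≃ₜ Y) : State X ≃ₜ State Y where
  toFun := map e
  invFun := map e.symm
  left_inv L := by
    ext f
    simp [ContinuousMap.comp_assoc]
  right_inv L := by
    ext f
    simp [ContinuousMap.comp_assoc]
  continuous_toFun := continuous_map _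
  continuous_invFun := continuous_map _

/-- The evaluation at a point, as a state. -/
def dirac (x : X) : State X where
  toLinearMap := (ContinuousMap.evalCLM ℝ x).toLinearMap
  nonneg _ hf := hf x
  map_one := rfl

@[simp]
theorem dirac_apply (x : X) (f : C(X, ℝ)) : dirac x f = f x := rfl

theorem continuous_dirac : Continuous (dirac : X → State X) :=
  continuous_iff.2 fun f => f.continuous

theorem dirac_injective [CompactSpace X] [T2Space X] :
    Function.Injective (dirac : X → State X) := by
  intro x y h
  by_contra hxy
  obtain ⟨f, hf, hf', -⟩ := exists_continuous_zero_one_of_isClosed (isClosed_singleton (x := x))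
    (isClosed_singleton (x := y)) (by simpa using hxy)
  have h1 : f x = f y := congrArg (fun L : State X => L f) h
  rw [hf rfl, hf' rfl] at h1
  simp at h1

/-- The midpoint of two states. -/
def midpoint (L M : State X) : State X where
  toLinearMap := (2⁻¹ : ℝ) • (L.toLinearMap + M.toLinearMap)
  nonneg f hf := by
    have := L.nonneg f hf
    have := M.nonneg f hf
    simp only [LinearMap.smul_apply, LinearMap.add_apply, smul_eq_mul]
    positivity
  map_one := by
    simp only [LinearMap.smul_apply, LinearMap.add_apply, L.map_one, M.map_one]
    norm_num

theorem midpoint_apply (L M : State X) (f : C(X, ℝ)) : midpoint L M f = 2⁻¹ * (L f + M f) := rfl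

section Compact

variable [CompactSpace X]

theorem abs_apply_le (L : State X) (f : C(X, ℝ)) : |L f| ≤ ‖f‖ := by
  rw [abs_le]
  constructor
  · rw [← L.apply_smul_one (-‖f‖)]
    exact L.apply_mono fun x => by simpa using (abs_le.1 (f.norm_coe_le_norm x)).1
  · rw [← L.apply_smul_one ‖f‖]
    exact L.apply_mono fun x => by simpa using (abs_le.1 (f.norm_coe_le_norm x)).2

theorem continuous_coe (L : State X) : Continuous (L : C(X, ℝ) → ℝ) :=
  (L.toLinearMap.mkContinuous 1 fun f => by
    rw [one_mul]; exact L.abs_apply_le f).continuous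

instance : CompactSpace (State X) := by
  have hind : Topology.IsInducing (fun (L : State X) (f : C(X, ℝ)) => L f) := ⟨rfl⟩
  have hr : Set.range (fun (L : State X) (f : C(X, ℝ)) => L f) =
      {l | (∀ f g, l (f + g) = l f + l g) ∧ (∀ (c : ℝ) f, l (c • f) = c * l f) ∧
        (∀ f, 0 ≤ f → 0 ≤ l f) ∧ l 1 = 1} := by
    ext l
    constructor
    · rintro ⟨L, rfl⟩
      exact ⟨map_add L, map_smul L, L.nonneg, L.map_one⟩
    · rintro ⟨h1, h2, h3, h4⟩
      exact ⟨⟨⟨⟨l, h1⟩, h2⟩, h3, h4⟩, rfl⟩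
  rw [← isCompact_univ_iff, hind.isCompact_iff, Set.image_univ]
  refine IsCompact.of_isClosed_subset
    (isCompact_univ_pi fun f : C(X, ℝ) => isCompact_Icc (a := -‖f‖) (b := ‖f‖)) ?_ ?_
  · rw [hr]
    simp only [Set.ofPred_and, Set.ofPred_forall]
    refine .inter (isClosed_iInter fun f => isClosed_iInter fun g => ?_)
      (.inter (isClosed_iInter fun c => isClosed_iInter fun f => ?_)
      (.inter (isClosed_iInter fun f => isClosed_iInter fun _ => ?_) ?_))
    · exact isClosed_eq (by fun_prop) (by fun_prop)
    · exact isClosed_eq (by fun_prop) (by fun_prop)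
    · exact isClosed_le (by fun_prop) (by fun_prop)
    · exact isClosed_eq (by fun_prop) (by fun_prop)
  · rintro _ ⟨L, rfl⟩ f -
    exact abs_le.1 (L.abs_apply_le f)

end Compact

/-! ### Characters -/

/-- A state is a character if `L (f²) = (L f)²` for all `f`, i.e. if no function has a variance; by
polarization, `L` is then multiplicative. -/
def IsCharacter (L : State X) : Prop := ∀ f, L (f * f) = L f * L f

theorem isCharacter_dirac (x : X) : (dirac x).IsCharacter := fun _ => rfl

theorem IsCharacter.map {L : State X} (h : L.IsCharacter) (p : C(X, Y)) :
    (map p L).IsCharacter := fun f => h (f.comp p)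

theorem isClosed_setOf_isCharacter : IsClosed {L : State X | L.IsCharacter} := by
  simp only [IsCharacter, Set.ofPred_forall]
  exact isClosed_iInter fun f =>
    isClosed_eq (continuous_eval _) ((continuous_eval f).mul (continuous_eval f))

theorem mul_self_apply_le (L : State X) (f : C(X, ℝ)) : L f * L f ≤ L (f * f) := by
  have h : 0 ≤ L ((f - L f • 1) * (f - L f • 1)) :=
    L.apply_nonneg fun x => mul_self_nonneg ((f - L f • 1) x)
  have e : (f - L f • 1) * (f - L f • 1) = f * f - (2 * L f) • f + (L f * L f) • 1 := by
    ext x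
    simp
    ring
  rw [e, map_add, map_sub, map_smul, map_smul, apply_one, smul_eq_mul, smul_eq_mul] at h
  linarith

/-- The degenerate case of the Cauchy-Schwarz inequality. -/
theorem apply_mul_eq_zero (L : State X) {k : C(X, ℝ)} (hk : L (k * k) = 0) (h : C(X, ℝ)) :
    L (k * h) = 0 := by
  have key : ∀ r : ℝ, 0 ≤ 2 * r * L (k * h) + L (h * h) := fun r => by
    have h0 : 0 ≤ L ((r • k + h) * (r • k + h)) :=
      L.apply_nonneg fun x => mul_self_nonneg ((r • k + h) x)
    have e : (r • k + h) * (r • k + h) = (r * r) • (k * k) + (2 * r) • (k * h) + h * h := by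
      ext x
      simp
      ring
    rw [e, map_add, map_add, map_smul, map_smul, hk] at h0
    simpa using h0
  by_contra hne
  -- The affine function of `r` in `key` takes the value `-1` at this point.
  have := key (-(L (h * h) + 1) / (2 * L (k * h)))
  have e : 2 * (-(L (h * h) + 1) / (2 * L (k * h))) * L (k * h) = -(L (h * h) + 1) := by
    field_simp
  linarith

/-- Elements of the multiplicative domain factor out: `f - L f` has `L`-norm zero. -/
theorem apply_mul_of_apply_mul_self (L : State X) {f : C(X, ℝ)} (hf : L (f * f) = L f * L f)
    (h : C(X, ℝ)) : L (f * h) = L f * L h := by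
  have e : (f - L f • 1) * (f - L f • 1) = f * f - (2 * L f) • f + (L f * L f) • 1 := by
    ext x
    simp
    ring
  have h0 : L ((f - L f • 1) * (f - L f • 1)) = 0 := by
    rw [e, map_add, map_sub, map_smul, map_smul, apply_one, smul_eq_mul, smul_eq_mul, hf]
    ring
  have h1 := L.apply_mul_eq_zero h0 h
  rw [sub_mul, map_sub, smul_mul_assoc, map_smul, one_mul, smul_eq_mul] at h1
  linarith

/-- The multiplicative domain of a state: the functions `f` of variance zero. By the Cauchy-Schwarz
inequality these satisfy `L (f h) = L f L h` for all `h`, so that they form a subalgebra. -/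
def multiplicativeDomain (L : State X) : Subalgebra ℝ C(X, ℝ) where
  carrier := {f | L (f * f) = L f * L f}
  mul_mem' {f h} hf hh := by
    have e : f * h * (f * h) = f * (f * (h * h)) := by ring
    change L (f * h * (f * h)) = L (f * h) * L (f * h)
    rw [e, L.apply_mul_of_apply_mul_self hf, L.apply_mul_of_apply_mul_self hf,
      L.apply_mul_of_apply_mul_self hf, hh]
    ring
  add_mem' {f h} hf hh := by
    have e : (f + h) * (f + h) = f * f + (f * h + f * h) + h * h := by ring
    change L ((f + h) * (f + h)) = L (f + h) * L (f + h)
    have hh' : L (h * h) = L h * L h := hh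
    rw [e, map_add, map_add, map_add, map_add, L.apply_mul_of_apply_mul_self hf f,
      L.apply_mul_of_apply_mul_self hf h, hh']
    ring
  algebraMap_mem' c := by
    change L (algebraMap ℝ C(X, ℝ) c * algebraMap ℝ C(X, ℝ) c) =
      L (algebraMap ℝ C(X, ℝ) c) * L (algebraMap ℝ C(X, ℝ) c)
    rw [← map_mul, Algebra.algebraMap_eq_smul_one, Algebra.algebraMap_eq_smul_one]
    simp

/-- By the Stone-Weierstrass theorem, being a character can be tested on the marginals along a
family of maps that separates points. -/
theorem isCharacter_of_separating [CompactSpace X] {I : Type*} {A : I → Type*}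
    [∀ i, TopologicalSpace (A i)] [∀ i, CompactSpace (A i)] [∀ i, T2Space (A i)]
    (p : ∀ i, C(X, A i)) (hp : ∀ x y, (∀ i, p i x = p i y) → x = y) (L : State X)
    (h : ∀ i, (map (p i) L).IsCharacter) : L.IsCharacter := by
  have hsep : L.multiplicativeDomain.SeparatesPoints := by
    intro x y hxy
    obtain ⟨i, hi⟩ : ∃ i, p i x ≠ p i y := by
      by_contra! hcon
      exact hxy (hp x y hcon)
    obtain ⟨f, hf, hf', -⟩ := exists_continuous_zero_one_of_isClosed
      (isClosed_singleton (x := p i x)) (isClosed_singleton (x := p i y)) (by simpa using hi)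
    refine ⟨_, ⟨f.comp (p i), h i f, rfl⟩, ?_⟩
    have h0 : f (p i x) = 0 := hf rfl
    have h1 : f (p i y) = 1 := hf' rfl
    simp [h0, h1]
  have hcl : IsClosed (L.multiplicativeDomain : Set C(X, ℝ)) :=
    isClosed_eq (L.continuous_coe.comp (continuous_id.mul continuous_id))
      (L.continuous_coe.mul L.continuous_coe)
  have htop := ContinuousMap.subalgebra_topologicalClosure_eq_top_of_separatesPoints _ hsep
  intro f
  have hf : f ∈ closure (L.multiplicativeDomain : Set C(X, ℝ)) := by
    rw [← Subalgebra.topologicalClosure_coe, htop]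
    trivial
  rwa [hcl.closure_eq] at hf

/-- If a character differed from every point evaluation, then by compactness a finite sum of squares
`(f - L f)²` would be bounded below, although `L` vanishes on it. -/
theorem IsCharacter.exists_eq_dirac [CompactSpace X] {L : State X} (h : L.IsCharacter) :
    ∃ x, L = dirac x := by
  by_contra! hne
  have hx : ∀ x, ∃ f : C(X, ℝ), L f ≠ f x := fun x => by
    by_contra! hcon
    exact hne x (State.ext hcon)
  choose f hf using hx
  obtain ⟨s, hs⟩ := isCompact_univ.elim_finite_subcover (fun x => {y | L (f x) ≠ f x y})
    (fun x => isOpen_ne_fun continuous_const (f x).continuous)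
    (fun x _ => Set.mem_iUnion.2 ⟨x, hf x⟩)
  let F : C(X, ℝ) := ∑ x ∈ s, (f x - L (f x) • 1) * (f x - L (f x) • 1)
  have hF0 : L F = 0 := by
    rw [map_sum]
    refine Finset.sum_eq_zero fun x _ => ?_
    rw [h, map_sub, apply_smul_one, sub_self, zero_mul]
  have hFpos : ∀ y, 0 < F y := fun y => by
    obtain ⟨x, hxs, hxy⟩ := Set.mem_iUnion₂.1 (hs (Set.mem_univ y))
    have hxy' : f x y - L (f x) ≠ 0 := sub_ne_zero.2 (Ne.symm hxy)
    simp only [F, ContinuousMap.sum_apply]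
    refine Finset.sum_pos' (fun z _ => mul_self_nonneg ((f z - L (f z) • 1) y)) ⟨x, hxs, ?_⟩
    simpa using mul_self_pos.2 hxy'
  obtain hX | hX := isEmpty_or_nonempty X
  · have : (1 : C(X, ℝ)) = 0 := ContinuousMap.ext fun x => isEmptyElim x
    have h1 := L.apply_one
    rw [this, map_zero] at h1
    exact zero_ne_one h1
  obtain ⟨y, -, hy⟩ := isCompact_univ.exists_isMinOn Set.univ_nonempty F.continuous.continuousOn
  have := L.apply_mono (f := F y • 1) (g := F) fun z => by simpa using hy (Set.mem_univ z)
  rw [apply_smul_one, hF0] at this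
  exact (hFpos y).not_ge this

theorem isCharacter_iff [CompactSpace X] {L : State X} : L.IsCharacter ↔ ∃ x, L = dirac x :=
  ⟨fun h => h.exists_eq_dirac, by rintro ⟨x, rfl⟩; exact isCharacter_dirac x⟩

/-- Characters are extreme points of the state space. -/
theorem eq_of_isCharacter_midpoint {L M : State X} (h : (midpoint L M).IsCharacter) : L = M := by
  ext f
  have h1 := h f
  have h2 := L.mul_self_apply_le f
  have h3 := M.mul_self_apply_le f
  rw [midpoint_apply, midpoint_apply] at h1
  nlinarith [mul_self_nonneg (L f - M f)]

end State

/-! ### Radon probability measures as states -/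

namespace RadonProb

section

attribute [local instance] borel borelSpace_borel

variable {X : Type t} {Y : Type s} [TopologicalSpace X] [TopologicalSpace Y]
  [CompactSpace X] [CompactSpace Y]

theorem integrable (μ : RadonProb X) (f : C(X, ℝ)) : Integrable f (μ.1 : Measure X) :=
  (BoundedContinuousFunction.mkOfCompact f).integrable _

/-- The state given by integration against a measure. -/
def toState (μ : RadonProb X) : State X where
  toLinearMap :=
    { toFun := fun f => ∫ x, f x ∂(μ.1 : Measure X)
      map_add' := fun f g => integral_add (μ.integrable f) (μ.integrable g)
      map_smul' := fun c f => integral_smul c f }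
  nonneg f hf := integral_nonneg hf
  map_one := by simp

theorem toState_apply (μ : RadonProb X) (f : C(X, ℝ)) :
    μ.toState f = ∫ x, f x ∂(μ.1 : Measure X) := rfl

theorem toState_map (e : X ≃ₜ Y) (μ : RadonProb X) :
    (map e μ).toState = State.map e μ.toState := by
  ext f
  exact integral_map e.continuous.measurable.aemeasurable
    f.continuous.measurable.aestronglyMeasurable

theorem continuous_toState : Continuous (toState : RadonProb X → State X) :=
  State.continuous_iff.2 fun f =>
    (ProbabilityMeasure.continuous_integral_boundedContinuousFunction
      (BoundedContinuousFunction.mkOfCompact f)).comp continuous_subtype_val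

theorem toState_injective [T2Space X] : Function.Injective (toState : RadonProb X → State X) := by
  intro μ ν h
  apply Subtype.ext
  apply ProbabilityMeasure.toMeasure_injective
  have := μ.2
  have := ν.2
  exact Measure.ext_of_integral_eq_on_compactlySupported fun f =>
    congrArg (fun L : State X => L f.toContinuousMap) h

/-- The Riesz-Markov-Kakutani representation theorem, for states. -/
theorem toState_surjective [T2Space X] : Function.Surjective (toState : RadonProb X → State X) := by
  intro L
  let Λ : CompactlySupportedContinuousMap X ℝ →ₚ[ℝ] ℝ := PositiveLinearMap.mk₀
    { toFun := fun f => L f.toContinuousMap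
      map_add' := fun f g => map_add L f.toContinuousMap g.toContinuousMap
      map_smul' := fun c f => map_smul L c f.toContinuousMap }
    fun f hf => L.apply_nonneg fun x => hf x
  have hint : ∀ f : C(X, ℝ), ∫ x, f x ∂(RealRMK.rieszMeasure Λ) = L f := fun f =>
    RealRMK.integral_rieszMeasure Λ ⟨f, HasCompactSupport.of_compactSpace f⟩
  have hprob : IsProbabilityMeasure (RealRMK.rieszMeasure Λ) := by
    have h1 := hint 1
    simp only [ContinuousMap.one_apply, integral_const, smul_eq_mul, mul_one,
      State.apply_one] at h1
    refine ⟨?_⟩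
    rw [← ENNReal.ofReal_toReal (measure_ne_top (RealRMK.rieszMeasure Λ) Set.univ)]
    change ENNReal.ofReal ((RealRMK.rieszMeasure Λ).real Set.univ) = 1
    rw [h1, ENNReal.ofReal_one]
  exact ⟨⟨⟨RealRMK.rieszMeasure Λ, hprob⟩, RealRMK.regular_rieszMeasure Λ⟩, State.ext hint⟩

/-- The homeomorphism between Radon probability measures and states. -/
def stateHomeomorph (X : Type t) [TopologicalSpace X] [CompactSpace X] [T2Space X] :
    RadonProb X ≃ₜ State X where
  toEquiv := Equiv.ofBijective toState ⟨toState_injective, toState_surjective⟩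
  continuous_toFun := continuous_toState
  continuous_invFun := by
    refine Continuous.subtype_mk (f := fun L => (Function.surjInv toState_surjective L).1)
      (ProbabilityMeasure.continuous_iff_forall_continuous_integral.2 fun f => ?_) _
    convert State.continuous_eval (X := X) f.toContinuousMap using 2 with L
    exact congrArg (fun M : State X => M f.toContinuousMap)
      (Function.surjInv_eq toState_surjective L)

theorem regular_dirac {X : Type t} [TopologicalSpace X] [T2Space X] (x : X) :
    (Measure.dirac x).Regular := by
  have : (Measure.dirac x).InnerRegular := ⟨fun U hU c hc => by
    have hx : x ∈ U := by
      by_contra hx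
      rw [Measure.dirac_apply' x hU, Set.indicator_of_notMem hx] at hc
      exact not_lt_zero hc
    rw [Measure.dirac_apply_of_mem hx] at hc
    exact ⟨{x}, Set.singleton_subset_iff.2 hx, isCompact_singleton, by
      rwa [Measure.dirac_apply_of_mem (Set.mem_singleton x)]⟩⟩
  infer_instance

theorem mem_pointMasses_iff [T2Space X] (μ : RadonProb X) :
    μ ∈ pointMasses X ↔ μ.toState.IsCharacter := by
  rw [State.isCharacter_iff]
  constructor
  · rintro ⟨x, hx⟩
    refine ⟨x, State.ext fun f => ?_⟩
    rw [toState_apply, hx, integral_dirac, State.dirac_apply]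
  · rintro ⟨x, hx⟩
    let ν : RadonProb X := ⟨⟨Measure.dirac x, inferInstance⟩, regular_dirac x⟩
    have : μ = ν := toState_injective <| by
      rw [hx]
      ext f
      exact (integral_dirac (fun y => f y) x).symm
    exact ⟨x, by rw [this]; rfl⟩

end

end RadonProb

/-! ### Maps and subspaces -/

namespace GSpace

variable {𝒢 : Type u} [Groupoid.{v} 𝒢]

theorem act_inv_act (X : GSpace.{u, v, t} 𝒢) {a b : 𝒢} (g : a ⟶ b) (x : X.fibre a) :
    X.act (Groupoid.inv g) (X.act g x) = x := by
  rw [← X.act_comp, Groupoid.comp_inv, X.act_id]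

theorem act_act_inv (X : GSpace.{u, v, t} 𝒢) {a b : 𝒢} (g : a ⟶ b) (x : X.fibre b) :
    X.act g (X.act (Groupoid.inv g) x) = x := by
  rw [← X.act_comp, Groupoid.inv_comp, X.act_id]

end GSpace

namespace GMap

variable {𝒢 : Type u} [Groupoid.{v} 𝒢]
variable {X : GSpace.{u, v, t} 𝒢} {Y : GSpace.{u, v, s} 𝒢} {Z : GSpace.{u, v, w} 𝒢}

/-- The identity `𝒢`-map. -/
def id (X : GSpace.{u, v, t} 𝒢) : GMap X X where
  toFun _ x := x
  continuous_toFun _ := continuous_id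
  map_act _ _ := rfl

/-- The composition of `𝒢`-maps. -/
def comp (Ψ : GMap Y Z) (Φ : GMap X Y) : GMap X Z where
  toFun a x := Ψ.toFun a (Φ.toFun a x)
  continuous_toFun a := (Ψ.continuous_toFun a).comp (Φ.continuous_toFun a)
  map_act g x := by rw [Ψ.map_act, Φ.map_act]

/-- The projection from a product of `𝒢`-spaces to a factor. -/
def proj {I : Type s} (X : I → GSpace.{u, v, t} 𝒢) (i : I) : GMap (GSpace.prod X) (X i) where
  toFun _ x := x i
  continuous_toFun _ := continuous_apply i
  map_act _ _ := rfl

/-- The inclusion of a `𝒢`-subspace. -/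
def incl (Z : GSubspace X) : GMap Z.toGSpace X where
  toFun _ x := x.1
  continuous_toFun _ := continuous_subtype_val
  map_act _ _ := rfl

/-- The continuous map between the fibres over a unit. -/
def toContinuousMap (Φ : GMap X Y) (a : 𝒢) : C(X.fibre a, Y.fibre a) :=
  ⟨Φ.toFun a, Φ.continuous_toFun a⟩

end GMap

namespace GSubspace

variable {𝒢 : Type u} [Groupoid.{v} 𝒢] {X : GSpace.{u, v, t} 𝒢} {Y : GSpace.{u, v, s} 𝒢}

/-- Since the arrows are invertible, a family of subsets that is mapped into itself by all of them
is invariant. -/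
def ofMapsTo (C : ∀ a, Set (X.fibre a)) (hC : ∀ a, IsCompact (C a)) (hne : ∀ a, (C a).Nonempty)
    (h : ∀ {a b : 𝒢} (g : a ⟶ b), ∀ x ∈ C a, X.act g x ∈ C b) : GSubspace X where
  carrier := C
  isCompact := hC
  nonempty := hne
  image_act g := by
    refine Set.Subset.antisymm (Set.image_subset_iff.2 (h g)) fun x hx => ?_
    exact ⟨_, h (Groupoid.inv g) x hx, X.act_act_inv g x⟩

theorem act_mem (Z : GSubspace X) {a b : 𝒢} (g : a ⟶ b) {x : X.fibre a} (hx : x ∈ Z.carrier a) :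
    X.act g x ∈ Z.carrier b :=
  Z.image_act g ▸ Set.mem_image_of_mem _ hx

/-- The image of a compact `𝒢`-space under a `𝒢`-map. -/
def range [X.IsCompactHausdorff] (Φ : GMap X Y) : GSubspace Y :=
  ofMapsTo (fun a => Set.range (Φ.toFun a)) (fun a => isCompact_range (Φ.continuous_toFun a))
    (fun a => Set.range_nonempty _) (by
      rintro a b g _ ⟨x, rfl⟩
      exact ⟨X.act g x, (Φ.map_act g x).symm⟩)

instance [X.IsCompactHausdorff] (Z : GSubspace X) : Z.toGSpace.IsCompactHausdorff where
  compact a := isCompact_iff_compactSpace.1 (Z.isCompact a)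
  t2 a := inferInstanceAs (T2Space (Z.carrier a))
  nonempty a := (Z.nonempty a).to_subtype

end GSubspace

namespace GSpace

variable {𝒢 : Type u} [Groupoid.{v} 𝒢]

theorem IsMinimal.surjective {X : GSpace.{u, v, t} 𝒢} {Y : GSpace.{u, v, s} 𝒢}
    [X.IsCompactHausdorff] (hY : Y.IsMinimal) (Φ : GMap X Y) (a : 𝒢) :
    Function.Surjective (Φ.toFun a) :=
  Set.range_eq_univ.1 (hY (GSubspace.range Φ) a)

instance {I : Type s} (X : I → GSpace.{u, v, t} 𝒢) [∀ i, (X i).IsCompactHausdorff] :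
    (prod X).IsCompactHausdorff where
  compact a := inferInstanceAs (CompactSpace (∀ i, (X i).fibre a))
  t2 a := inferInstanceAs (T2Space (∀ i, (X i).fibre a))
  nonempty a := inferInstanceAs (Nonempty (∀ i, (X i).fibre a))

/-- Minimal subspaces exist by Zorn's lemma: the intersection of a chain of `𝒢`-subspaces is fibrewise
non-empty by compactness. The family of fibres of a subspace is encoded as one subset of the disjoint
union of the fibres. -/
theorem exists_minimal_subspace (X : GSpace.{u, v, t} 𝒢) [X.IsCompactHausdorff] :
    ∃ Z : GSubspace X, Z.toGSpace.IsMinimal := by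
  let S : Set (Set (Σ a, X.fibre a)) := {s | (∀ a, IsClosed {x | (⟨a, x⟩ : Σ a, X.fibre a) ∈ s}) ∧
    (∀ a, {x | (⟨a, x⟩ : Σ a, X.fibre a) ∈ s}.Nonempty) ∧
    ∀ (a b : 𝒢) (g : a ⟶ b) (x : X.fibre a), ⟨a, x⟩ ∈ s → ⟨b, X.act g x⟩ ∈ s}
  have hchain : ∀ c ⊆ S, IsChain (· ⊆ ·) c → ⋂₀ c ∈ S := by
    intro c hcS hc
    refine ⟨fun a => ?_, fun a => ?_, ?_⟩
    · have : {x | (⟨a, x⟩ : Σ a, X.fibre a) ∈ ⋂₀ c} =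
          ⋂ s ∈ c, {x | (⟨a, x⟩ : Σ a, X.fibre a) ∈ s} := by
        ext x; simp
      rw [this]
      exact isClosed_biInter fun s hs => (hcS hs).1 a
    · obtain rfl | hne := c.eq_empty_or_nonempty
      · simp
      have := hne.to_subtype
      obtain ⟨x, hx⟩ := IsCompact.nonempty_iInter_of_directed_nonempty_isCompact_isClosed
        (fun s : c => {x | (⟨a, x⟩ : Σ a, X.fibre a) ∈ s.1})
        (fun s r => by
          obtain h | h := hc.total s.2 r.2
          · exact ⟨s, subset_rfl, fun x hx => h hx⟩
          · exact ⟨r, fun x hx => h hx, subset_rfl⟩)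
        (fun s => (hcS s.2).2.1 a) (fun s => ((hcS s.2).1 a).isCompact) (fun s => (hcS s.2).1 a)
      exact ⟨x, fun s hs => Set.mem_iInter.1 hx ⟨s, hs⟩⟩
    · exact fun a b g x hx s hs => (hcS hs).2.2 a b g x (hx s hs)
  obtain ⟨m, hm⟩ := zorn_superset S fun c hcS hc =>
    ⟨⋂₀ c, hchain c hcS hc, fun s hs => Set.sInter_subset_of_mem hs⟩
  let Z : GSubspace X := GSubspace.ofMapsTo (fun a => {x | (⟨a, x⟩ : Σ a, X.fibre a) ∈ m})
    (fun a => (hm.prop.1 a).isCompact) hm.prop.2.1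
    fun {a b} g x hx => hm.prop.2.2 a b g x hx
  refine ⟨Z, fun W a => Set.eq_univ_of_forall fun x => ?_⟩
  let s : Set (Σ a, X.fibre a) := {p | p.2 ∈ Subtype.val '' W.carrier p.1}
  have hs : s ∈ S := by
    refine ⟨fun a => ((W.isCompact a).image continuous_subtype_val).isClosed,
      fun a => (W.nonempty a).image Subtype.val, ?_⟩
    rintro a b g x ⟨y, hy, hyx⟩
    exact ⟨_, W.act_mem g hy, congrArg (X.act g) hyx⟩
  have hsm : s ⊆ m := by
    rintro ⟨b, x⟩ ⟨y, -, hyx⟩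
    change y.1 = x at hyx
    exact hyx ▸ y.2
  have hxs : (⟨a, x.1⟩ : Σ a, X.fibre a) ∈ s := hm.le_of_le hs hsm x.2
  obtain ⟨y, hy, hyx⟩ := hxs
  rwa [← Subtype.ext hyx]

/-! ### Strong proximality in terms of states -/

/-- The bundle of state spaces, with the action by push-forward. -/
def states (X : GSpace.{u, v, t} 𝒢) : GSpace.{u, v, t} 𝒢 where
  fibre a := State (X.fibre a)
  act g := State.mapHomeomorph (X.act g)
  act_id a L := State.ext fun f => congrArg L (ContinuousMap.ext fun x => by
    exact congrArg f (X.act_id a x))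
  act_comp g h L := State.ext fun f => congrArg L (ContinuousMap.ext fun x => by
    exact congrArg f (X.act_comp g h x))

instance (X : GSpace.{u, v, t} 𝒢) (a : 𝒢) : T2Space (X.states.fibre a) :=
  inferInstanceAs (T2Space (State (X.fibre a)))

/-- The `𝒢`-map from measures to states given by integration. -/
def probToStates (X : GSpace.{u, v, t} 𝒢) [X.IsCompactHausdorff] : GMap X.prob X.states where
  toFun _ μ := RadonProb.toState μ
  continuous_toFun _ := RadonProb.continuous_toState
  map_act g μ := (RadonProb.toState_map (X.act g) μ).symm

/-- The embedding of a `𝒢`-space into the bundle of its states. -/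
def diracMap (X : GSpace.{u, v, t} 𝒢) : GMap X X.states where
  toFun _ x := State.dirac x
  continuous_toFun _ := State.continuous_dirac
  map_act _ _ := rfl

theorem isStronglyProximal_iff (X : GSpace.{u, v, t} 𝒢) [X.IsCompactHausdorff] :
    X.IsStronglyProximal ↔ ∀ a b : 𝒢, Nonempty (a ⟶ b) → ∀ L : State (X.fibre a),
      ∃ M ∈ closure (Set.range fun g : a ⟶ b => State.map (X.act g : C(X.fibre a, X.fibre b)) L),
        M.IsCharacter := by
  have key : ∀ (a b : 𝒢) (μ : RadonProb (X.fibre a)) (ν : RadonProb (X.fibre b)),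
      ν ∈ closure (Set.range fun g : a ⟶ b => X.prob.act g μ) ↔
        ν.toState ∈
          closure (Set.range fun g : a ⟶ b =>
            State.map (X.act g : C(X.fibre a, X.fibre b)) μ.toState) := by
    intro a b μ ν
    let e := RadonProb.stateHomeomorph (X.fibre b)
    have : (Set.range fun g : a ⟶ b => State.map (X.act g : C(X.fibre a, X.fibre b)) μ.toState) =
        e '' Set.range fun g : a ⟶ b => X.prob.act g μ := by
      refine Eq.trans ?_ (Set.range_comp e fun g : a ⟶ b => RadonProb.map (X.act g) μ)
      exact congrArg Set.range (funext fun g => (RadonProb.toState_map (X.act g) μ).symm)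
    rw [this, ← e.image_closure]
    exact (e.injective.mem_set_image).symm
  refine forall₃_congr fun a b _ => ⟨fun h L => ?_, fun h μ => ?_⟩
  · obtain ⟨μ, rfl⟩ := RadonProb.toState_surjective L
    obtain ⟨ν, hν, hν'⟩ := h μ
    exact ⟨ν.toState, (key a b μ ν).1 hν, (RadonProb.mem_pointMasses_iff ν).1 hν'⟩
  · obtain ⟨M, hM, hM'⟩ := h μ.toState
    obtain ⟨ν, rfl⟩ := RadonProb.toState_surjective M
    exact ⟨ν, (key a b μ ν).2 hM, (RadonProb.mem_pointMasses_iff ν).2 hM'⟩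

/-- Strong proximality is inherited along a family of `𝒢`-maps that jointly separates points. In the
closed orbit of a state, the states with finitely many marginals a character form a non-empty set:
a further marginal is made a character by passing to the limit along arrows `b ⟶ b`, which preserves
the previous ones. By compactness all marginals can be made characters at once. -/
theorem IsStronglyProximal.of_separating {X : GSpace.{u, v, t} 𝒢} [X.IsCompactHausdorff]
    {I : Type w} {A : I → GSpace.{u, v, s} 𝒢} [∀ i, (A i).IsCompactHausdorff]
    (hA : ∀ i, (A i).IsStronglyProximal) (p : ∀ i, GMap X (A i))
    (hp : ∀ a (x y : X.fibre a), (∀ i, (p i).toFun a x = (p i).toFun a y) → x = y) :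
    X.IsStronglyProximal := by
  rw [isStronglyProximal_iff]
  rintro a b ⟨g₀⟩ L
  set K := closure (Set.range fun g : a ⟶ b => State.map (X.act g : C(X.fibre a, X.fibre b)) L) with hK
  let C : I → Set (State (X.fibre b)) := fun i =>
    {M | (State.map ((p i).toContinuousMap b) M).IsCharacter}
  have hC : ∀ i, IsClosed (C i) := fun i =>
    State.isClosed_setOf_isCharacter.preimage (State.continuous_map _)
  have hCact : ∀ (i : I) (h : b ⟶ b), ∀ M ∈ C i,
      State.map (X.act h : C(X.fibre b, X.fibre b)) M ∈ C i := by
    intro i h M hM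
    have e : State.map ((p i).toContinuousMap b) (State.map (X.act h : C(X.fibre b, X.fibre b)) M) =
        State.map ((A i).act h : C((A i).fibre b, (A i).fibre b))
            (State.map ((p i).toContinuousMap b) M) :=
      State.ext fun f => congrArg M (ContinuousMap.ext fun x => by
        exact congrArg f ((p i).map_act h x).symm)
    change (State.map _ (State.map _ M)).IsCharacter
    rw [e]
    exact State.IsCharacter.map hM _
  have hKact : ∀ (h : b ⟶ b), ∀ M ∈ K, State.map (X.act h : C(X.fibre b, X.fibre b)) M ∈ K := by
    intro h M hM
    refine map_mem_closure (State.continuous_map _) hM ?_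
    rintro _ ⟨g, rfl⟩
    exact ⟨g ≫ h, X.states.act_comp g h L⟩
  have hfin : ∀ s : Finset I, (K ∩ ⋂ i ∈ s, C i).Nonempty := by
    classical
    intro s
    induction s using Finset.induction_on with
    | empty => exact ⟨_, subset_closure ⟨g₀, rfl⟩, by simp⟩
    | insert i s _ ih =>
      obtain ⟨M, hMK, hMC⟩ := ih
      let O := closure (Set.range fun h : b ⟶ b => State.map (X.act h : C(X.fibre b, X.fibre b)) M)
      have hOK : O ⊆ K := closure_minimal (by
        rintro _ ⟨h, rfl⟩
        exact hKact h M hMK) isClosed_closure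
      have hOC : ∀ j ∈ s, O ⊆ C j := fun j hj => closure_minimal (by
        rintro _ ⟨h, rfl⟩
        exact hCact j h M (Set.mem_iInter₂.1 hMC j hj)) (hC j)
      obtain ⟨N, hN, hN'⟩ := (isStronglyProximal_iff (A i)).1 (hA i) b b ⟨𝟙 b⟩
        (State.map ((p i).toContinuousMap b) M)
      have hsub : closure (Set.range fun h : b ⟶ b =>
          State.map ((A i).act h : C((A i).fibre b, (A i).fibre b))
            (State.map ((p i).toContinuousMap b) M)) ⊆
          State.map ((p i).toContinuousMap b) '' O := by
        refine closure_minimal ?_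
          (isClosed_closure.isCompact.image (State.continuous_map _)).isClosed
        rintro _ ⟨h, rfl⟩
        refine ⟨_, subset_closure ⟨h, rfl⟩, State.ext fun f => congrArg M
          (ContinuousMap.ext fun x => by exact congrArg f ((p i).map_act h x).symm)⟩
      obtain ⟨M', hM', rfl⟩ := hsub hN
      refine ⟨M', hOK hM', ?_⟩
      simp only [Finset.mem_insert, Set.mem_iInter]
      rintro j (rfl | hj)
      · exact hN'
      · exact hOC j hj hM'
  obtain ⟨M, hMK, hMC⟩ := (isClosed_closure (s := Set.range fun g : a ⟶ b =>
    State.map (X.act g : C(X.fibre a, X.fibre b)) L)).isCompact.inter_iInter_nonempty C hC hfin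
  exact ⟨M, hMK, State.isCharacter_of_separating (fun i => (p i).toContinuousMap b) (hp b) M
    fun i => Set.mem_iInter.1 hMC i⟩

/-! ### Maps from a minimal space into the states of a boundary -/

section Rigidity

variable {X : GSpace.{u, v, t} 𝒢} {Y : GSpace.{u, v, s} 𝒢}
  [X.IsCompactHausdorff] [Y.IsCompactHausdorff]

/-- The points of `Y` with image a character form a `𝒢`-subspace; it is non-empty since the closed
orbit of `Φ y` lies in the image of `Φ`. -/
theorem isCharacter_of_isMinimal (hX : X.IsStronglyProximal) (hY : Y.IsMinimal)
    (Φ : GMap Y X.states) (a : 𝒢) (y : Y.fibre a) : State.IsCharacter (Φ.toFun a y) := by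
  let W : GSubspace Y := GSubspace.ofMapsTo (fun a => {y | State.IsCharacter (Φ.toFun a y)})
    (fun a => (State.isClosed_setOf_isCharacter.preimage (Φ.continuous_toFun a)).isCompact)
    (fun a => by
      obtain ⟨y⟩ : Nonempty (Y.fibre a) := inferInstance
      obtain ⟨M, hM, hM'⟩ := (isStronglyProximal_iff X).1 hX a a ⟨𝟙 a⟩ (Φ.toFun a y)
      have : M ∈ Set.range (Φ.toFun a) := by
        refine closure_minimal ?_ (isCompact_range (Φ.continuous_toFun a)).isClosed hM
        rintro _ ⟨g, rfl⟩
        exact ⟨Y.act g y, (Φ.map_act g y).symm⟩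
      obtain ⟨z, rfl⟩ := this
      exact ⟨z, hM'⟩)
    (fun {a b} g y hy => by
      change State.IsCharacter (Φ.toFun b (Y.act g y))
      rw [← Φ.map_act]
      exact State.IsCharacter.map hy _)
  exact Set.eq_univ_iff_forall.1 (hY W a) y

theorem dirac_mem_range_of_isBoundary (hX : X.IsBoundary) (hY : Y.IsMinimal)
    (Φ : GMap Y X.states) (a : 𝒢) (x : X.fibre a) : ∃ y, Φ.toFun a y = State.dirac x := by
  let W : GSubspace X := GSubspace.ofMapsTo (fun a => {x | ∃ y, Φ.toFun a y = State.dirac x})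
    (fun a => ((isCompact_range (Φ.continuous_toFun a)).isClosed.preimage
      State.continuous_dirac).isCompact)
    (fun a => by
      obtain ⟨y⟩ : Nonempty (Y.fibre a) := inferInstance
      obtain ⟨x, hx⟩ := (isCharacter_of_isMinimal hX.2.2 hY Φ a y).exists_eq_dirac
      exact ⟨x, y, hx⟩)
    (fun {a b} g x ⟨y, hy⟩ => ⟨Y.act g y, by rw [← Φ.map_act, hy]; rfl⟩)
  exact Set.eq_univ_iff_forall.1 (hX.2.1 W a) x

/-- The midpoint of two `𝒢`-maps into the states is another one. All its values are characters, which
are extreme, so that the two maps agree. -/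
theorem eq_of_isMinimal (hX : X.IsStronglyProximal) (hY : Y.IsMinimal) (Φ Ψ : GMap Y X.states) :
    Φ = Ψ := by
  let Θ : GMap Y X.states :=
    { toFun := fun a y => State.midpoint (Φ.toFun a y) (Ψ.toFun a y)
      continuous_toFun := fun a => State.continuous_iff.2 fun f => by
        have h1 := (State.continuous_eval f).comp (Φ.continuous_toFun a)
        have h2 := (State.continuous_eval f).comp (Ψ.continuous_toFun a)
        exact continuous_const.mul (h1.add h2)
      map_act := fun g y => by
        rw [← Φ.map_act, ← Ψ.map_act]
        rfl }
  apply GMap.ext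
  funext a y
  exact State.eq_of_isCharacter_midpoint (isCharacter_of_isMinimal hX hY Θ a y)

theorem range_eq_pointMasses (hX : X.IsBoundary) (hY : Y.IsMinimal) (Φ : GMap Y X.prob) (a : 𝒢) :
    Set.range (Φ.toFun a) = RadonProb.pointMasses (X.fibre a) := by
  ext μ
  refine Iff.trans ?_ (RadonProb.mem_pointMasses_iff μ).symm
  constructor
  · rintro ⟨y, rfl⟩
    exact isCharacter_of_isMinimal hX.2.2 hY (X.probToStates.comp Φ) a y
  · intro h
    obtain ⟨x, hx⟩ := h.exists_eq_dirac
    obtain ⟨y, hy⟩ := dirac_mem_range_of_isBoundary hX hY (X.probToStates.comp Φ) a x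
    exact ⟨y, RadonProb.toState_injective (hy.trans hx.symm)⟩

theorem prob_eq_of_isMinimal (hX : X.IsStronglyProximal) (hY : Y.IsMinimal) (Φ Ψ : GMap Y X.prob) :
    Φ = Ψ := by
  have h := eq_of_isMinimal hX hY (X.probToStates.comp Φ) (X.probToStates.comp Ψ)
  apply GMap.ext
  funext a y
  exact RadonProb.toState_injective (congrFun (congrFun (congrArg GMap.toFun h) a) y)

theorem gmap_eq_of_isMinimal (hX : X.IsStronglyProximal) (hY : Y.IsMinimal) (Φ Ψ : GMap Y X) :
    Φ = Ψ := by
  have h := eq_of_isMinimal hX hY (X.diracMap.comp Φ) (X.diracMap.comp Ψ)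
  apply GMap.ext
  funext a y
  exact State.dirac_injective (congrFun (congrFun (congrArg GMap.toFun h) a) y)

end Rigidity

end GSpace

/-! ### Morphisms between algebras of functions -/

/-- A real continuous function, as a complex one. -/
def ContinuousMap.complexify {X : Type t} [TopologicalSpace X] (f : C(X, ℝ)) : C(X, ℂ) :=
  ⟨fun x => (f x : ℂ), by fun_prop⟩

theorem ContinuousMap.exists_complexify {X : Type t} [TopologicalSpace X] (f : C(X, ℂ)) :
    ∃ h k : C(X, ℝ), f = h.complexify + Complex.I • k.complexify := by
  refine ⟨⟨fun x => (f x).re, by fun_prop⟩, ⟨fun x => (f x).im, by fun_prop⟩, ?_⟩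
  ext x
  simp only [ContinuousMap.complexify, ContinuousMap.add_apply, ContinuousMap.smul_apply,
    ContinuousMap.coe_mk, smul_eq_mul]
  rw [mul_comm, Complex.re_add_im]

namespace CompletelyPositiveMap

variable {X : Type t} {Y : Type s} [TopologicalSpace X] [TopologicalSpace Y]
  [CompactSpace X] [CompactSpace Y]

theorem apply_complexify_nonneg (φ : C(X, ℂ) →CP C(Y, ℂ)) {f : C(X, ℝ)} (hf : 0 ≤ f) (y : Y) :
    0 ≤ φ f.complexify y := by
  have h : (0 : C(X, ℂ)) ≤ f.complexify := fun x => by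
    simpa [ContinuousMap.complexify] using hf x
  have h1 := OrderHomClass.mono φ h
  rw [map_zero] at h1
  exact h1 y

/-- The state `f ↦ φ(f)(y)` defined by a unital completely positive map and a point. -/
def stateAt (φ : C(X, ℂ) →CP C(Y, ℂ)) (h1 : φ 1 = 1) (y : Y) : State X where
  toLinearMap :=
    { toFun := fun f => (φ f.complexify y).re
      map_add' := fun f g => by
        have : (f + g).complexify = f.complexify + g.complexify := by
          ext x; simp [ContinuousMap.complexify]
        rw [this, map_add]
        simp
      map_smul' := fun c f => by
        have : (c • f).complexify = (c : ℂ) • f.complexify := by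
          ext x; simp [ContinuousMap.complexify]
        rw [this, map_smul]
        simp }
  nonneg _ hf := (Complex.nonneg_iff.1 (φ.apply_complexify_nonneg hf y)).1
  map_one := by
    have : (1 : C(X, ℝ)).complexify = 1 := by ext x; simp [ContinuousMap.complexify]
    change (φ (1 : C(X, ℝ)).complexify y).re = 1
    rw [this, h1]
    simp

theorem apply_complexify (φ : C(X, ℂ) →CP C(Y, ℂ)) (h1 : φ 1 = 1) (y : Y) (f : C(X, ℝ)) :
    φ f.complexify y = (φ.stateAt h1 y f : ℂ) := by
  -- `f` is the difference of the non-negative functions `f + ‖f‖` and `‖f‖`.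
  have hpos : (0 : C(X, ℝ)) ≤ f + ‖f‖ • 1 := fun x => by
    have := (abs_le.1 (f.norm_coe_le_norm x)).1
    simp
    linarith
  have him := (Complex.nonneg_iff.1 (φ.apply_complexify_nonneg hpos y)).2
  have e : (f + ‖f‖ • 1).complexify = f.complexify + (‖f‖ : ℂ) • 1 := by
    ext x; simp [ContinuousMap.complexify]
  rw [e, map_add, map_smul, h1] at him
  apply Complex.ext
  · rfl
  · simpa using him.symm

theorem continuous_stateAt (φ : C(X, ℂ) →CP C(Y, ℂ)) (h1 : φ 1 = 1) :
    Continuous (φ.stateAt h1) :=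
  State.continuous_iff.2 fun f => Complex.continuous_re.comp (φ f.complexify).continuous

theorem ext_of_stateAt {φ ψ : C(X, ℂ) →CP C(Y, ℂ)} (hφ : φ 1 = 1) (hψ : ψ 1 = 1)
    (h : ∀ y, φ.stateAt hφ y = ψ.stateAt hψ y) : φ = ψ := by
  refine DFunLike.ext _ _ fun f => ContinuousMap.ext fun y => ?_
  obtain ⟨p, q, rfl⟩ := f.exists_complexify
  simp only [map_add, map_smul, ContinuousMap.add_apply, ContinuousMap.smul_apply,
    apply_complexify _ hφ, apply_complexify _ hψ, h]

theorem apply_of_stateAt_eq_dirac {φ : C(X, ℂ) →CP C(Y, ℂ)} (h1 : φ 1 = 1) {x : X} {y : Y}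
    (h : φ.stateAt h1 y = State.dirac x) (f : C(X, ℂ)) : φ f y = f x := by
  obtain ⟨p, q, rfl⟩ := f.exists_complexify
  simp only [map_add, map_smul, ContinuousMap.add_apply, ContinuousMap.smul_apply,
    apply_complexify _ h1, h]
  rfl

end CompletelyPositiveMap

/-! ### Rigidity of morphisms into a minimal space -/

namespace FunctionMorphism

variable {𝒢 : Type u} [Groupoid.{v} 𝒢] {X : GSpace.{u, v, t} 𝒢} {Y : GSpace.{u, v, s} 𝒢}
  [X.IsCompactHausdorff] [Y.IsCompactHausdorff]

/-- The `𝒢`-map from `Y` to the states of `X` dual to a morphism from `C(X)` to `C(Y)`. -/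
def toStates (Φ : FunctionMorphism X Y) : GMap Y X.states where
  toFun a y := (Φ.toFun a).stateAt (Φ.map_one a) y
  continuous_toFun a := (Φ.toFun a).continuous_stateAt (Φ.map_one a)
  map_act {a b} g y := by
    refine State.ext fun f => congrArg Complex.re ?_
    have e : X.translate g (f.comp (X.act g : C(X.fibre a, X.fibre b))).complexify = f.complexify := by
      ext x
      exact congrArg (fun z => (f z : ℂ)) (X.act_act_inv g x)
    have h := DFunLike.congr_fun
      (Φ.map_translate g (f.comp (X.act g : C(X.fibre a, X.fibre b))).complexify) (Y.act g y)
    rw [e] at h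
    rw [← h]
    exact congrArg (Φ.toFun a _) (Y.act_inv_act g y).symm

theorem isStarIsometric (hX : X.IsBoundary) (hY : Y.IsMinimal) (Φ : FunctionMorphism X Y) :
    Φ.IsStarIsometric := by
  intro a
  have hpt : ∀ y, ∃ x, ∀ f, Φ.toFun a f y = f x := fun y => by
    obtain ⟨x, hx⟩ := (GSpace.isCharacter_of_isMinimal hX.2.2 hY Φ.toStates a y).exists_eq_dirac
    exact ⟨x, CompletelyPositiveMap.apply_of_stateAt_eq_dirac (Φ.map_one a) hx⟩
  refine ⟨fun f h => ?_, fun f => ?_, AddMonoidHomClass.isometry_of_norm _ fun f => ?_⟩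
  · ext y
    obtain ⟨x, hx⟩ := hpt y
    simp [hx]
  · ext y
    obtain ⟨x, hx⟩ := hpt y
    simp [hx]
  · apply le_antisymm
    · refine (ContinuousMap.norm_le _ (norm_nonneg _)).2 fun y => ?_
      obtain ⟨x, hx⟩ := hpt y
      rw [hx]
      exact f.norm_coe_le_norm x
    · refine (ContinuousMap.norm_le _ (norm_nonneg _)).2 fun x => ?_
      obtain ⟨y, hy⟩ := GSpace.dirac_mem_range_of_isBoundary hX hY Φ.toStates a x
      rw [← CompletelyPositiveMap.apply_of_stateAt_eq_dirac (Φ.map_one a) hy]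
      exact (Φ.toFun a f).norm_coe_le_norm y

theorem eq_of_isMinimal (hX : X.IsStronglyProximal) (hY : Y.IsMinimal)
    (Φ Ψ : FunctionMorphism X Y) : Φ = Ψ := by
  have h := GSpace.eq_of_isMinimal hX hY Φ.toStates Ψ.toStates
  have h' : Φ.toFun = Ψ.toFun := by
    funext a
    exact CompletelyPositiveMap.ext_of_stateAt (Φ.map_one a) (Ψ.map_one a) fun y =>
      congrFun (congrFun (congrArg GMap.toFun h) a) y
  cases Φ
  cases Ψ
  congr

end FunctionMorphism

/-! ### A set of representatives of all boundaries -/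

/-- The structure of a `𝒢`-space on a given family of types. -/
structure GStructure {𝒢 : Type u} [Groupoid.{v} 𝒢] (F : 𝒢 → Type t) where
  top : ∀ a, TopologicalSpace (F a)
  act : ∀ {a b : 𝒢}, (a ⟶ b) → F a ≃ₜ F b
  act_id : ∀ (a : 𝒢) (x : F a), act (𝟙 a) x = x
  act_comp : ∀ {a b c : 𝒢} (g : a ⟶ b) (h : b ⟶ c) (x : F a), act (g ≫ h) x = act h (act g x)

/-- The bundle given by a family of types and a structure on it. -/
def GStructure.toGSpace {𝒢 : Type u} [Groupoid.{v} 𝒢] {F : 𝒢 → Type t} (S : GStructure F) :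
    GSpace.{u, v, t} 𝒢 where
  fibre := F
  top := S.top
  act := S.act
  act_id := S.act_id
  act_comp := S.act_comp

namespace GSpace

variable {𝒢 : Type u} [Groupoid.{v} 𝒢]

/-- Transport of the structure of a `𝒢`-space along fibrewise bijections. -/
def transport (X : GSpace.{u, v, t} 𝒢) {F : 𝒢 → Type s} (e : ∀ a, X.fibre a ≃ F a) :
    GStructure F :=
  letI (a : 𝒢) : TopologicalSpace (F a) := .induced (e a).symm inferInstance
  let h (a : 𝒢) : F a ≃ₜ X.fibre a := (e a).symm.toHomeomorphOfIsInducing ⟨rfl⟩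
  { top := fun _ => inferInstance
    act := fun {a b} g => (h a).trans ((X.act g).trans (h b).symm)
    act_id := fun a x => by
      change (h a).symm (X.act (𝟙 a) (h a x)) = x
      rw [X.act_id, Homeomorph.symm_apply_apply]
    act_comp := fun {a b c} g k x => by
      change (h c).symm (X.act (g ≫ k) (h a x)) =
        (h c).symm (X.act k (h b ((h b).symm (X.act g (h a x)))))
      rw [X.act_comp, Homeomorph.apply_symm_apply] }

theorem transport_isomorphic (X : GSpace.{u, v, t} 𝒢) {F : 𝒢 → Type s}
    (e : ∀ a, X.fibre a ≃ F a) : (X.transport e).toGSpace.Isomorphic X := by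
  let (a : 𝒢) : TopologicalSpace (F a) := .induced (e a).symm inferInstance
  let h (a : 𝒢) : F a ≃ₜ X.fibre a := (e a).symm.toHomeomorphOfIsInducing ⟨rfl⟩
  refine ⟨⟨fun a => h a, fun a => (h a).continuous, fun {a b} g x => ?_⟩,
    ⟨fun a => (h a).symm, fun a => (h a).symm.continuous, fun {a b} g x => ?_⟩,
    fun a x => (h a).symm_apply_apply x, fun a x => (h a).apply_symm_apply x⟩
  · exact ((h b).apply_symm_apply (X.act g (h a x))).symm
  · change (h b).symm (X.act g (h a ((h a).symm x))) = (h b).symm (X.act g x)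
    rw [Homeomorph.apply_symm_apply]

theorem IsBoundary.of_isomorphic {X : GSpace.{u, v, t} 𝒢} {Y : GSpace.{u, v, s} 𝒢}
    (hX : X.IsBoundary) (h : Y.Isomorphic X) : Y.IsBoundary := by
  obtain ⟨Φ, Ψ, h1, h2⟩ := h
  have := hX.1
  let e (a : 𝒢) : Y.fibre a ≃ₜ X.fibre a :=
    ⟨⟨Φ.toFun a, Ψ.toFun a, h1 a, h2 a⟩, Φ.continuous_toFun a, Ψ.continuous_toFun a⟩
  have hY : Y.IsCompactHausdorff :=
    ⟨fun a => (e a).symm.compactSpace, fun a => (e a).symm.t2Space, fun a => ⟨(e a).symm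
      (Classical.arbitrary _)⟩⟩
  refine ⟨hY, fun W a => Set.eq_univ_of_forall fun y => ?_,
    IsStronglyProximal.of_separating (I := Unit) (fun _ => hX.2.2) (fun _ => Φ)
      fun a x y hxy => (e a).injective (hxy ())⟩
  obtain ⟨w, hw⟩ := hX.2.1.surjective (Φ.comp (GMap.incl W)) a (Φ.toFun a y)
  rw [← (e a).injective hw]
  exact w.2

/-- Orbits in a minimal space are dense: their closures, together with the full fibres over units not
connected to the given one, form a `𝒢`-subspace. -/
theorem IsMinimal.dense_orbit {X : GSpace.{u, v, t} 𝒢} [X.IsCompactHausdorff] (hX : X.IsMinimal)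
    {a : 𝒢} (x : X.fibre a) : Dense (Set.range fun g : a ⟶ a => X.act g x) := by
  let W : GSubspace X := GSubspace.ofMapsTo
    (fun b => closure {y | IsEmpty (a ⟶ b) ∨ ∃ g : a ⟶ b, y = X.act g x})
    (fun b => isClosed_closure.isCompact)
    (fun b => by
      obtain h | ⟨⟨g⟩⟩ := isEmpty_or_nonempty (a ⟶ b)
      · exact ⟨Classical.arbitrary _, subset_closure (.inl h)⟩
      · exact ⟨_, subset_closure (.inr ⟨g, rfl⟩)⟩)
    (fun {b c} g y hy => by
      refine map_mem_closure (X.act g).continuous hy ?_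
      rintro y (h | ⟨k, rfl⟩)
      · exact .inl ⟨fun k => h.false (k ≫ Groupoid.inv g)⟩
      · exact .inr ⟨k ≫ g, (X.act_comp k g x).symm⟩)
  have h := hX W a
  rw [dense_iff_closure_eq, ← h]
  congr 1
  ext y
  constructor
  · rintro ⟨g, rfl⟩
    exact .inr ⟨g, rfl⟩
  · rintro (h | ⟨g, rfl⟩)
    · exact (h.false (𝟙 a)).elim
    · exact ⟨g, rfl⟩

/-- A point of a minimal space is determined by the sets of arrows whose orbit adheres to it. -/
theorem IsMinimal.exists_injective {X : GSpace.{u, v, t} 𝒢} [X.IsCompactHausdorff]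
    (hX : X.IsMinimal) (a : 𝒢) : ∃ j : X.fibre a → Set (Set (a ⟶ a)), Function.Injective j := by
  obtain ⟨x⟩ : Nonempty (X.fibre a) := inferInstance
  refine ⟨fun y => {A | y ∈ closure ((fun g : a ⟶ a => X.act g x) '' A)}, fun y z hyz => ?_⟩
  by_contra hne
  obtain ⟨U, V, hU, hV, hy, hz, hd⟩ := t2_separation hne
  let A : Set (a ⟶ a) := {g | X.act g x ∈ U}
  have hyA : y ∈ closure ((fun g : a ⟶ a => X.act g x) '' A) := by
    rw [mem_closure_iff]
    intro O hO hyO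
    obtain ⟨_, ⟨hwO, hwU⟩, g, rfl⟩ :=
      (hX.dense_orbit x).inter_open_nonempty (O ∩ U) (hO.inter hU) ⟨y, hyO, hy⟩
    exact ⟨_, hwO, g, hwU, rfl⟩
  have hzA : z ∈ closure ((fun g : a ⟶ a => X.act g x) '' A) :=
    (Set.ext_iff.1 hyz A).1 hyA
  obtain ⟨_, hV', g, hg, rfl⟩ := mem_closure_iff.1 hzA V hV hz
  exact hd.le_bot ⟨hg, hV'⟩

/-- The index set of a complete family of boundaries: all boundaries whose fibre over each unit `a`
is, as a set, a subset of `Set (Set (a ⟶ a))`. -/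
def BoundaryCode (𝒢 : Type u) [Groupoid.{v} 𝒢] : Type (max u v w) :=
  Σ s : ∀ a : 𝒢, Set (ULift.{max u v w} (Set (Set (a ⟶ a)))),
    {S : GStructure (fun a => s a) // S.toGSpace.IsBoundary}

theorem isCompleteFamilyOfBoundaries_boundaryCode (𝒢 : Type u) [Groupoid.{v} 𝒢] :
    IsCompleteFamilyOfBoundaries (fun c : BoundaryCode.{u, v, w} 𝒢 => c.2.1.toGSpace) := by
  refine ⟨fun c => c.2.2, fun Z hZ => ?_⟩
  have := hZ.1
  choose j hj using hZ.2.1.exists_injective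
  let e (a : 𝒢) : Z.fibre a ≃ Set.range fun x => ULift.up.{max u v w} (j a x) :=
    Equiv.ofInjective _ (ULift.up_injective.comp (hj a))
  have hiso := Z.transport_isomorphic e
  exact ⟨⟨_, Z.transport e, hZ.of_isomorphic hiso⟩, hiso⟩

/-! ### Furstenberg boundaries -/

/-- Every boundary is isomorphic to a factor of the product, onto which the minimal subspace projects
surjectively since the factor is minimal. -/
theorem IsCompleteFamilyOfBoundaries.isFurstenbergBoundary {I : Type t}
    {X : I → GSpace.{u, v, max t w} 𝒢} (hX : IsCompleteFamilyOfBoundaries X)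
    (Z : GSubspace (prod X)) (hZ : Z.toGSpace.IsMinimal) : Z.toGSpace.IsFurstenbergBoundary := by
  have (i : I) : (X i).IsCompactHausdorff := (hX.1 i).1
  refine ⟨⟨inferInstance, hZ, IsStronglyProximal.of_separating (fun i => (hX.1 i).2.2)
    (fun i => (GMap.proj X i).comp (GMap.incl Z)) fun a x y h => Subtype.ext (funext h)⟩,
    fun Y hY => ?_⟩
  obtain ⟨i, Φ, -⟩ := hX.2 Y hY
  exact ⟨Φ.comp ((GMap.proj X i).comp (GMap.incl Z)), hY.2.1.surjective _⟩

/-- The two compositions of the quotient maps are identities by rigidity. -/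
theorem IsFurstenbergBoundary.isomorphic {F F' : GSpace.{u, v, t} 𝒢}
    (hF : F.IsFurstenbergBoundary) (hF' : F'.IsFurstenbergBoundary) : F.Isomorphic F' := by
  have := hF.1.1
  have := hF'.1.1
  obtain ⟨Φ, -⟩ := hF.2 F' hF'.1
  obtain ⟨Ψ, -⟩ := hF'.2 F hF.1
  have h1 := gmap_eq_of_isMinimal hF.1.2.2 hF.1.2.1 (Ψ.comp Φ) (GMap.id F)
  have h2 := gmap_eq_of_isMinimal hF'.1.2.2 hF'.1.2.1 (Φ.comp Ψ) (GMap.id F')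
  exact ⟨Φ, Ψ, fun a x => congrFun (congrFun (congrArg GMap.toFun h1) a) x,
    fun a x => congrFun (congrFun (congrArg GMap.toFun h2) a) x⟩

end GSpace

end

theorem mainTheorem10 (𝒢 : Type u) [Groupoid.{v} 𝒢] :
    -- a Furstenberg boundary exists
    (∃ F : GSpace.{u, v, max u v w} 𝒢, F.IsFurstenbergBoundary) ∧
    -- it is unique up to isomorphism
    (∀ F F' : GSpace.{u, v, max u v w} 𝒢,
      F.IsFurstenbergBoundary → F'.IsFurstenbergBoundary → F.Isomorphic F') ∧
    -- it is obtained as a minimal subspace of the product of all boundaries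
    (∃ (I : Type (max u v w)) (X : I → GSpace.{u, v, max u v w} 𝒢),
      GSpace.IsCompleteFamilyOfBoundaries X) ∧
    (∀ (I : Type (max u v w)) (X : I → GSpace.{u, v, max u v w} 𝒢),
      GSpace.IsCompleteFamilyOfBoundaries X →
        (∃ Z : GSubspace (GSpace.prod X), Z.toGSpace.IsMinimal) ∧
        ∀ Z : GSubspace (GSpace.prod X), Z.toGSpace.IsMinimal → Z.toGSpace.IsFurstenbergBoundary) ∧
    -- maps from a minimal compact space into `P(X)`, for a boundary `X`, have range `X` and are
    -- unique; equivalently, every morphism `C(X) → C(Y)` is an isometric `*`-homomorphism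
    (∀ (X Y : GSpace.{u, v, max u v w} 𝒢) [X.IsCompactHausdorff] [Y.IsCompactHausdorff],
      X.IsBoundary → Y.IsMinimal →
        (∀ (Φ : GMap Y X.prob) (a : 𝒢),
          Set.range (Φ.toFun a) = RadonProb.pointMasses (X.fibre a)) ∧
        (∀ Φ Ψ : GMap Y X.prob, Φ = Ψ) ∧
        (∀ Φ : FunctionMorphism X Y, Φ.IsStarIsometric) ∧
        ∀ Φ Ψ : FunctionMorphism X Y, Φ = Ψ) := by
  have hprod : ∀ (I : Type (max u v w)) (X : I → GSpace.{u, v, max u v w} 𝒢),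
      GSpace.IsCompleteFamilyOfBoundaries X →
        ∃ Z : GSubspace (GSpace.prod X), Z.toGSpace.IsMinimal := fun I X hX => by
    have (i : I) : (X i).IsCompactHausdorff := (hX.1 i).1
    exact GSpace.exists_minimal_subspace _
  have hcomplete := GSpace.isCompleteFamilyOfBoundaries_boundaryCode.{u, v, w} 𝒢
  refine ⟨?_, fun F F' hF hF' => hF.isomorphic hF', ⟨_, _, hcomplete⟩, fun I X hX =>
    ⟨hprod I X hX, hX.isFurstenbergBoundary⟩, fun X Y _ _ hX hY =>
    ⟨GSpace.range_eq_pointMasses hX hY, GSpace.prob_eq_of_isMinimal hX.2.2 hY,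
      FunctionMorphism.isStarIsometric hX hY, FunctionMorphism.eq_of_isMinimal hX.2.2 hY⟩⟩
  obtain ⟨Z, hZ⟩ := hprod _ _ hcomplete
  exact ⟨Z.toGSpace, hcomplete.isFurstenbergBoundary Z hZ⟩
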